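/- **Definitions.** For a bounded set $A\subset\mathbb R^N$ and $\varepsilon>0$ let $A_\varepsilon=\{y: d(y,A)<\varepsilon\}$. The lower and upper $s$-dimensional Minkowski contents ($s\ge 0$) of $A$ are $\mathcal M_*^s(A)=\liminf_{\varepsilon\to0^+}|A_\varepsilon|/\varepsilon^{N-s}$ and $\mathcal M^{*s}(A)=\limsup_{\varepsilon\to0^+}|A_\varepsilon|/\varepsilon^{N-s}$. The lower and upper box dimensions of $A$ are $\underline{\dim}_BA=\inf\{s\ge0:\mathcal M_*^s(A)=0\}$ and $\overline{\dim}_BA=\inf\{s\ge0:\mathcal M^{*s}(A)=0\}$; if they coincide, the common value is the box dimension $\dim_BA$. A *spiral* is a curve $r=f(\varphi)$, $\varphi\ge\varphi_1>0$, in polar coordinates, where $f:[\varphi_1,\infty)\to(0,\infty)$ satisfies $f(\varphi)\to0$ as $\varphi\to\infty$ and $f$ is radially decreasing, i.e. for each $\varphi\ge\varphi_1$ the sequence $k\mapsto f(\varphi+2k\pi)$ is strictly decreasing; a curve $r=g(\varphi)$, $\varphi\le\varphi_1<0$, is also called a spiral if its mirror image $r=g(-\varphi)$, $\varphi\ge|\varphi_1|$,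 is one. Let $r:[t_0,\infty)\to(0,\infty)$ be $C^1$ with $r'(t_0)\le0$. Starting from $t_0$, define inductively for $k\ge 0$ $$t_{2k+1}=\inf\{t>t_{2k}: r'(t)>0\},\qquad t_{2k+2}=\inf\{t>t_{2k+1}: r(t)=r(t_{2k+1})\}.$$ The function $r$ is a *wavy function*, with constants $\varepsilon>0$ and $\alpha\in(0,1)$, if this sequence is well defined (the sets are nonempty) and (i) $(t_n)$ is strictly increasing and $t_n\to\infty$; (ii) $t_{2k+1}-t_{2k}\ge\varepsilon$ for all $k\ge 0$; (iii) $\max_{[t_{2k+1},t_{2k+2}]}r-\min_{[t_{2k+1},t_{2k+2}]}r=o\bigl(t_{2k+1}^{-\alpha-1}\bigr)$ as $k\to\infty$. A spiral $r=f(\varphi)$ is a *wavy spiral* if it has a reparametrization $\varphi=\varphi(t)$, $t\in[t_0,\infty)$, of class $C^1$ and strictly increasing or strictly decreasing, running over the whole domain of $f$, such that $t\mapsto f(\varphi(t))$ is a wavy function (for some constants). **Theorem (Box dimension of a wavy spiral).** Let $t_0>0$, and let $r:[t_0,\infty)\to(0,\infty)$ be a wavy function with constants $\varepsilon>0$ and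 $\alpha\in(0,1)$. Let $\varphi:[t_0,\infty)\to[\varphi_0,\infty)$ be a strictly increasing $C^1$ function with $\varphi(t_0)=\varphi_0>0$, such that for some $\bar\varphi_0\in\mathbb R$ $$|(\varphi(t)-\bar\varphi_0)-(t-t_0)|\to0\quad\text{as }t\to\infty .$$ Let $f:[\varphi_0,\infty)\to(0,\infty)$ be defined by $f(\varphi(t))=r(t)$, and assume that the curve $\Gamma'$ given in polar coordinates by $r=f(\varphi)$, $\varphi\ge\varphi_0$, is a spiral and that $f$ is differentiable on $[\varphi_0,\infty)$ (one-sidedly at $\varphi_0$). Let $0<\varepsilon'<\varepsilon$ and $\theta=\min\{\varepsilon',\pi\}$. Assume that there are positive constants $\underline m,\overline m,\underline a',M$ such that for all $\varphi\ge\varphi_0$ $$\underline m\,\varphi^{-\alpha}\le f(\varphi)\le\overline m\,\varphi^{-\alpha},\qquad |f'(\varphi)|\le M\varphi^{-\alpha-1},$$ and for all $\varphi\ge\varphi_0$ and all $\Delta\varphi$ with $\theta\le\Delta\varphi\le2\pi+\theta$ $$\underline a'\,\varphi^{-\alpha-1}\le f(\varphi)-f(\varphi+\Delta\varphi).$$ Then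 $\Gamma'$ is a wavy spiral and $$\dim_B\Gamma'=\frac{2}{1+\alpha}.$$ -/

import Mathlib

open Set Filter Topology MeasureTheory

noncomputable section

/-- Lower `s`-dimensional Minkowski content of a (bounded) set `A ⊆ ℝ^N`:
the lower limit of `|A_ε| / ε^(N-s)` as `ε → 0+`, where `A_ε = {y | d(y, A) < ε}`. -/
def lowerMinkowskiContent {N : ℕ} (s : ℝ) (A : Set (EuclideanSpace ℝ (Fin N))) : ENNReal :=
  liminf (fun ε : ℝ => volume (Metric.thickening ε A) / ENNReal.ofReal (ε ^ ((N : ℝ) - s)))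
    (𝓝[>] (0 : ℝ))

/-- Upper `s`-dimensional Minkowski content of a (bounded) set `A ⊆ ℝ^N`. -/
def upperMinkowskiContent {N : ℕ} (s : ℝ) (A : Set (EuclideanSpace ℝ (Fin N))) : ENNReal :=
  limsup (fun ε : ℝ => volume (Metric.thickening ε A) / ENNReal.ofReal (ε ^ ((N : ℝ) - s)))
    (𝓝[>] (0 : ℝ))

/-- Lower box dimension of a bounded set. -/
def lowerBoxDim {N : ℕ} (A : Set (EuclideanSpace ℝ (Fin N))) : ℝ :=
  sInf {s : ℝ | 0 ≤ s ∧ lowerMinkowskiContent s A = 0}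

/-- Upper box dimension of a bounded set. -/
def upperBoxDim {N : ℕ} (A : Set (EuclideanSpace ℝ (Fin N))) : ℝ :=
  sInf {s : ℝ | 0 ≤ s ∧ upperMinkowskiContent s A = 0}

/-- The set `A` is bounded, its lower and upper box dimensions coincide, and their common value
is `d`. -/
def HasBoxDim {N : ℕ} (A : Set (EuclideanSpace ℝ (Fin N))) (d : ℝ) : Prop :=
  Bornology.IsBounded A ∧ lowerBoxDim A = d ∧ upperBoxDim A = d

/-- The planar curve given in polar coordinates by `r = f φ`, `φ ∈ D`. -/
def polarGraph (f : ℝ → ℝ) (D : Set ℝ) : Set (EuclideanSpace ℝ (Fin 2)) :=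
  (fun φ : ℝ => !₂[f φ * Real.cos φ, f φ * Real.sin φ]) '' D

/-- `r = f φ`, `φ ≥ φ₁ > 0`, is a spiral: `f` is positive on `[φ₁, ∞)`, tends to `0` at infinity
and is radially decreasing. -/
structure IsSpiral (f : ℝ → ℝ) (φ₁ : ℝ) : Prop where
  pos_start : 0 < φ₁
  pos : ∀ φ, φ₁ ≤ φ → 0 < f φ
  tendsto_zero : Tendsto f atTop (𝓝 0)
  radially_decreasing : ∀ φ, φ₁ ≤ φ → StrictAnti (fun k : ℕ => f (φ + 2 * (k : ℝ) * Real.pi))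

/-- `r = g φ`, `φ ≤ φ₁ < 0`, is a spiral of the opposite orientation: its mirror image in the
`x`-axis is a spiral in the sense of `IsSpiral`. -/
def IsMirrorSpiral (g : ℝ → ℝ) (φ₁ : ℝ) : Prop :=
  φ₁ < 0 ∧ IsSpiral (fun φ => g (-φ)) |φ₁|

/-- Oscillation of `r` on a set `I`; the supremum and the infimum are a maximum and a minimum
for `r` continuous and `I` a nonempty compact interval. -/
def oscOn (r : ℝ → ℝ) (I : Set ℝ) : ℝ := sSup (r '' I) - sInf (r '' I)

/-- `t` is the sequence `t 0 = t₀`, `t (2k+1) = inf {s > t (2k) | r'(s) > 0}`,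
`t (2k+2) = inf {s > t (2k+1) | r(s) = r(t (2k+1))}`, and it is well defined: an empty set of reals
has no greatest lower bound, so each of these sets is nonempty. -/
structure IsWaveSequence (t₀ : ℝ) (r : ℝ → ℝ) (t : ℕ → ℝ) : Prop where
  zero : t 0 = t₀
  odd : ∀ k : ℕ, IsGLB {s : ℝ | t (2 * k) < s ∧ 0 < derivWithin r (Ici t₀) s} (t (2 * k + 1))
  even : ∀ k : ℕ, IsGLB {s : ℝ | t (2 * k + 1) < s ∧ r s = r (t (2 * k + 1))} (t (2 * k + 2))

/-- The waviness condition for the function `r` and the sequence `t`, with the constant `ε` in its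
second part and the exponent `α` in its third part. -/
structure WavinessCondition (r : ℝ → ℝ) (t : ℕ → ℝ) (ε α : ℝ) : Prop where
  strictMono : StrictMono t
  tendsto_atTop : Tendsto t atTop atTop
  eps_pos : 0 < ε
  eps_le : ∀ k : ℕ, ε ≤ t (2 * k + 1) - t (2 * k)
  alpha_mem : α ∈ Ioo (0 : ℝ) 1
  osc_isLittleO : (fun k : ℕ => oscOn r (Icc (t (2 * k + 1)) (t (2 * k + 2))))
    =o[atTop] (fun k : ℕ => t (2 * k + 1) ^ (-α - 1))

/-- `r : [t₀, ∞) → (0, ∞)` is a wavy function, with the constants `ε` and `α` in the waviness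
condition. -/
structure IsWavyFunctionWith (t₀ : ℝ) (r : ℝ → ℝ) (ε α : ℝ) : Prop where
  pos : ∀ s, t₀ ≤ s → 0 < r s
  contDiffOn : ContDiffOn ℝ 1 r (Ici t₀)
  deriv_start : derivWithin r (Ici t₀) t₀ ≤ 0
  wavy : ∃ t : ℕ → ℝ, IsWaveSequence t₀ r t ∧ WavinessCondition r t ε α

/-- `r : [t₀, ∞) → (0, ∞)` is a wavy function. -/
def IsWavyFunction (t₀ : ℝ) (r : ℝ → ℝ) : Prop :=
  ∃ ε α : ℝ, IsWavyFunctionWith t₀ r ε α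

/-- `r = f φ`, `φ ∈ D`, is a wavy spiral: it is a spiral (of either orientation) and it has a
strictly monotone reparametrization `φ` of class `C¹` of the whole curve by a half-line such that
`f ∘ φ` is a wavy function. -/
def IsWavySpiral (f : ℝ → ℝ) (D : Set ℝ) : Prop :=
  (∃ φ₁ : ℝ, (D = Ici φ₁ ∧ IsSpiral f φ₁) ∨ (D = Iic φ₁ ∧ IsMirrorSpiral f φ₁)) ∧
    ∃ (t₀ : ℝ) (φ : ℝ → ℝ), ContDiffOn ℝ 1 φ (Ici t₀) ∧
      (StrictMonoOn φ (Ici t₀) ∨ StrictAntiOn φ (Ici t₀)) ∧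
      φ '' Ici t₀ = D ∧ IsWavyFunction t₀ (fun s => f (φ s))

end

/-! Consecutive turns near angle `Φ` are at most of order `Φ ^ (-α - 1)` apart, so turns beyond `Φ ~
ε ^ (-1 / (1 + α))` merge in the `ε`-neighbourhood. They fill a disc of radius of order `Φ ^ (-α) ~
ε ^ (α / (1 + α))`, which bounds the area below (`eventually_le_volume_thickening_polarGraph`). The
arc before `Φ` has length of order at most `Φ ^ (1 - α)`, and its neighbourhood has area of order at
most `ε * Φ ^ (1 - α)`, comparable to the area of the disc
(`eventually_volume_thickening_polarGraph_le`). The total is of order `ε ^ (2 * α / (1 + α))`, and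
this exponent is `2 - 2 / (1 + α)`.

The curve is a wavy spiral because `φ` itself is the required reparametrization: `f ∘ φ` agrees with
`r` on the half-line. -/

/-! ### Box dimension from volume growth. -/

/-- The upper content vanishes for `s > d`, while the lower one is at least `c` for `s ≤ d`; both
sets of exponents in the definitions are therefore exactly `Ioi d`. -/
theorem hasBoxDim_of_volume_bounds {N : ℕ} {A : Set (EuclideanSpace ℝ (Fin N))} {d c C : ℝ}
    (hA : Bornology.IsBounded A) (hd : 0 ≤ d) (hc : 0 < c)
    (hlow : ∀ᶠ ε : ℝ in 𝓝[>] 0,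
      ENNReal.ofReal (c * ε ^ ((N : ℝ) - d)) ≤ volume (Metric.thickening ε A))
    (hup : ∀ᶠ ε : ℝ in 𝓝[>] 0,
      volume (Metric.thickening ε A) ≤ ENNReal.ofReal (C * ε ^ ((N : ℝ) - d))) :
    HasBoxDim A d := by
  have hpos : ∀ᶠ ε : ℝ in 𝓝[>] 0, 0 < ε := eventually_mem_nhdsWithin
  have hone : ∀ᶠ ε : ℝ in 𝓝[>] 0, ε < 1 :=
    (eventually_lt_nhds one_pos).filter_mono nhdsWithin_le_nhds
  have hle : ∀ s, lowerMinkowskiContent s A ≤ upperMinkowskiContent s A := fun s =>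
    liminf_le_limsup
  have hupper : ∀ s, d < s → upperMinkowskiContent s A = 0 := by
    intro s hs
    refine Tendsto.limsup_eq ?_
    have h0 : Tendsto (fun ε : ℝ => ENNReal.ofReal (C * ε ^ (s - d))) (𝓝[>] 0) (𝓝 0) := by
      have h1 : Tendsto (fun ε : ℝ => C * ε ^ (s - d)) (𝓝 0) (𝓝 (C * 0 ^ (s - d))) :=
        ((Real.continuousAt_rpow_const 0 (s - d) (Or.inr (by linarith))).tendsto).const_mul C
      rw [Real.zero_rpow (by linarith), mul_zero] at h1
      simpa using ENNReal.tendsto_ofReal (h1.mono_left nhdsWithin_le_nhds)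
    refine tendsto_of_tendsto_of_tendsto_of_le_of_le' tendsto_const_nhds h0
      (Eventually.of_forall fun _ => zero_le) ?_
    filter_upwards [hup, hpos] with ε h hε
    refine (ENNReal.div_le_div_right h _).trans ?_
    rw [← ENNReal.ofReal_div_of_pos (Real.rpow_pos_of_pos hε _), mul_div_assoc,
      ← Real.rpow_sub hε]
    exact le_of_eq (by congr 3; ring)
  have hlower : ∀ s, s ≤ d → lowerMinkowskiContent s A ≠ 0 := by
    intro s hs
    have : ENNReal.ofReal c ≤ lowerMinkowskiContent s A := by
      refine le_liminf_of_le (by isBoundedDefault) ?_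
      filter_upwards [hlow, hpos, hone] with ε h hε h1
      refine le_trans ?_ (ENNReal.div_le_div_right h _)
      rw [← ENNReal.ofReal_div_of_pos (Real.rpow_pos_of_pos hε _), mul_div_assoc,
        ← Real.rpow_sub hε]
      refine ENNReal.ofReal_le_ofReal (le_mul_of_one_le_right hc.le ?_)
      exact Real.one_le_rpow_of_pos_of_le_one_of_nonpos hε h1.le (by linarith)
    exact ((ENNReal.ofReal_pos.2 hc).trans_le this).ne'
  have e1 : {s : ℝ | 0 ≤ s ∧ lowerMinkowskiContent s A = 0} = Ioi d := by
    ext s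
    refine ⟨fun h => not_le.1 fun hs => hlower s hs h.2, fun h => ⟨hd.trans (le_of_lt h), ?_⟩⟩
    exact le_antisymm ((hle s).trans (hupper s h).le) zero_le
  have e2 : {s : ℝ | 0 ≤ s ∧ upperMinkowskiContent s A = 0} = Ioi d := by
    ext s
    refine ⟨fun h => not_le.1 fun hs => hlower s hs ?_,
      fun h => ⟨hd.trans (le_of_lt h), hupper s h⟩⟩
    exact le_antisymm ((hle s).trans h.2.le) zero_le
  exact ⟨hA, by rw [lowerBoxDim, e1, csInf_Ioi], by rw [upperBoxDim, e2, csInf_Ioi]⟩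

/-! ### Planar metric facts and neighbourhoods of Lipschitz arcs. -/

theorem EuclideanSpace.dist_fin_two_le (x y : EuclideanSpace ℝ (Fin 2)) :
    dist x y ≤ |x 0 - y 0| + |x 1 - y 1| := by
  rw [EuclideanSpace.dist_eq, Fin.sum_univ_two, Real.dist_eq, Real.dist_eq]
  refine Real.sqrt_le_iff.2 ⟨by positivity, ?_⟩
  nlinarith [abs_nonneg (x 0 - y 0), abs_nonneg (x 1 - y 1)]

theorem EuclideanSpace.dist_polar (ρ σ θ : ℝ) :
    dist (!₂[ρ * Real.cos θ, ρ * Real.sin θ] : EuclideanSpace ℝ (Fin 2))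
      !₂[σ * Real.cos θ, σ * Real.sin θ] = |ρ - σ| := by
  rw [EuclideanSpace.dist_eq, Fin.sum_univ_two, Real.dist_eq, Real.dist_eq, sq_abs, sq_abs,
    ← Real.sqrt_sq_eq_abs]
  congr 1
  simp only [Matrix.cons_val_zero, Matrix.cons_val_one]
  linear_combination (ρ - σ) ^ 2 * Real.sin_sq_add_cos_sq θ

theorem EuclideanSpace.volume_ball_fin_two_of_nonneg (x : EuclideanSpace ℝ (Fin 2)) {ρ : ℝ}
    (hρ : 0 ≤ ρ) : volume (Metric.ball x ρ) = ENNReal.ofReal (ρ ^ 2 * Real.pi) := by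
  rw [EuclideanSpace.volume_ball_fin_two, ENNReal.ofReal_mul (by positivity),
    ENNReal.ofReal_pow hρ]

theorem volume_thickening_image_Icc_le {γ : ℝ → EuclideanSpace ℝ (Fin 2)} {a b L ε : ℝ}
    (hL : 0 < L) (hε : 0 < ε) (hab : a ≤ b)
    (hγ : ∀ x y, a ≤ x → x ≤ y → y ≤ b → dist (γ x) (γ y) ≤ L * (y - x)) :
    volume (Metric.thickening ε (γ '' Icc a b)) ≤
      ENNReal.ofReal ((L * (b - a) / ε + 1) * (4 * ε ^ 2 * Real.pi)) := by
  have hq : 0 ≤ L * (b - a) / ε := div_nonneg (mul_nonneg hL.le (sub_nonneg.2 hab)) hε.le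
  -- Nodes `ε / L` apart have images at most `ε` apart, so each point of the neighbourhood is within
  -- `2 * ε` of the image of the last node before its parameter.
  have hcov : Metric.thickening ε (γ '' Icc a b) ⊆
      ⋃ i ∈ Finset.range (⌊L * (b - a) / ε⌋₊ + 1), Metric.ball (γ (a + i * (ε / L))) (2 * ε) := by
    intro z hz
    obtain ⟨_, ⟨u, ⟨hau, hub⟩, rfl⟩, hzu⟩ := Metric.mem_thickening_iff.1 hz
    have hu0 : 0 ≤ L * (u - a) / ε := div_nonneg (mul_nonneg hL.le (sub_nonneg.2 hau)) hε.le
    have hi := Nat.floor_le hu0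
    have hi' := Nat.lt_floor_add_one (L * (u - a) / ε)
    have hmono : ⌊L * (u - a) / ε⌋₊ ≤ ⌊L * (b - a) / ε⌋₊ := Nat.floor_le_floor (by gcongr)
    generalize ⌊L * (u - a) / ε⌋₊ = i at hi hi' hmono
    rw [le_div_iff₀ hε] at hi
    rw [div_lt_iff₀ hε] at hi'
    have e : L * (a + i * (ε / L)) = L * a + i * ε := by field_simp
    have hiu : a + i * (ε / L) ≤ u := le_of_mul_le_mul_left (by linarith) hL
    simp only [mem_iUnion, Finset.mem_range, Metric.mem_ball]
    refine ⟨i, by omega, ?_⟩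
    have h1 := hγ (a + i * (ε / L)) u (le_add_of_nonneg_right (by positivity)) hiu hub
    have h2 := dist_triangle_right z (γ (a + i * (ε / L))) (γ u)
    linarith
  refine (measure_mono hcov).trans ((measure_biUnion_finset_le _ _).trans ?_)
  simp only [EuclideanSpace.volume_ball_fin_two_of_nonneg _ (mul_pos two_pos hε).le,
    Finset.sum_const, Finset.card_range, nsmul_eq_mul]
  rw [ENNReal.ofReal_mul (p := L * (b - a) / ε + 1) (by linarith), ← ENNReal.ofReal_natCast]
  refine mul_le_mul' (ENNReal.ofReal_le_ofReal ?_) (ENNReal.ofReal_le_ofReal ?_)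
  · push_cast
    linarith [Nat.floor_le hq]
  · exact le_of_eq (by ring)

/-! ### Length estimates along the spiral. -/

/-- Adding `g` or `-g` to the primitive of `K * x ^ (-α)` gives a monotone function. This avoids
integrating `g'`, which need not be continuous. -/
theorem abs_sub_le_rpow_sub_rpow {g g' : ℝ → ℝ} {x₀ K α : ℝ} (hx₀ : 0 < x₀) (hα : α < 1)
    (hg : ∀ x, x₀ ≤ x → HasDerivWithinAt g (g' x) (Ici x₀) x)
    (hg' : ∀ x, x₀ ≤ x → |g' x| ≤ K * x ^ (-α)) {x y : ℝ} (hx : x₀ ≤ x) (hxy : x ≤ y) :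
    |g x - g y| ≤ K / (1 - α) * (y ^ (1 - α) - x ^ (1 - α)) := by
  have hB : ∀ s, x₀ ≤ s → HasDerivAt (fun s : ℝ => K / (1 - α) * s ^ (1 - α))
      (K * s ^ (-α)) s := by
    intro s hs
    have h := (Real.hasDerivAt_rpow_const (p := 1 - α)
      (Or.inl (hx₀.trans_le hs).ne')).const_mul (K / (1 - α))
    have hα' : 1 - α ≠ 0 := by linarith
    have e : K / (1 - α) * ((1 - α) * s ^ (1 - α - 1)) = K * s ^ (-α) := by
      rw [show 1 - α - 1 = -α by ring]
      field_simp
    rwa [e] at h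
  have hcont : ∀ σ : ℝ, ContinuousOn (fun s => K / (1 - α) * s ^ (1 - α) + σ * g s) (Ici x₀) :=
    fun σ s hs => ((hB s hs).continuousAt.continuousWithinAt).add
      ((hg s hs).continuousWithinAt.const_mul σ)
  have hmono : ∀ σ : ℝ, |σ| = 1 →
      MonotoneOn (fun s => K / (1 - α) * s ^ (1 - α) + σ * g s) (Ici x₀) := by
    intro σ hσ
    have hd : ∀ s, s ∈ interior (Ici x₀) →
        HasDerivAt (fun s => K / (1 - α) * s ^ (1 - α) + σ * g s) (K * s ^ (-α) + σ * g' s) s := by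
      intro s hs
      rw [interior_Ici] at hs
      exact (hB s (le_of_lt hs)).add
        (((hg s (le_of_lt hs)).hasDerivAt (Ici_mem_nhds hs)).const_mul σ)
    refine monotoneOn_of_deriv_nonneg (convex_Ici _) (hcont σ)
      (fun s hs => (hd s hs).differentiableAt.differentiableWithinAt) fun s hs => ?_
    rw [(hd s hs).deriv]
    have h1 : |σ * g' s| = |g' s| := by rw [abs_mul, hσ, one_mul]
    have h2 := neg_abs_le (σ * g' s)
    have h3 := hg' s (interior_subset hs)
    linarith
  have h1 := hmono 1 (by simp) hx (hx.trans hxy : x₀ ≤ y) hxy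
  have h2 := hmono (-1) (by simp) hx (hx.trans hxy : x₀ ≤ y) hxy
  simp only at h1 h2
  rw [abs_le]
  constructor <;> linarith

theorem dist_polarCurve_le {f f' : ℝ → ℝ} {x₀ m M α : ℝ} (hx₀ : 0 < x₀) (hα : α < 1) (hM : 0 ≤ M)
    (hf : ∀ x, x₀ ≤ x → |f x| ≤ m * x ^ (-α))
    (hd : ∀ x, x₀ ≤ x → HasDerivWithinAt f (f' x) (Ici x₀) x)
    (hf' : ∀ x, x₀ ≤ x → |f' x| ≤ M * x ^ (-α - 1)) {x y : ℝ} (hx : x₀ ≤ x) (hxy : x ≤ y) :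
    dist (!₂[f x * Real.cos x, f x * Real.sin x] : EuclideanSpace ℝ (Fin 2))
        !₂[f y * Real.cos y, f y * Real.sin y] ≤
      2 * ((M / x₀ + m) / (1 - α)) * (y ^ (1 - α) - x ^ (1 - α)) := by
  have key : ∀ s, x₀ ≤ s → |f' s| + |f s| ≤ (M / x₀ + m) * s ^ (-α) := by
    intro s hs
    have hs0 : 0 < s := hx₀.trans_le hs
    have h1 := hf' s hs
    have h2 := hf s hs
    have h3 : M * s ^ (-α - 1) ≤ M / x₀ * s ^ (-α) := by
      rw [Real.rpow_sub_one hs0.ne', mul_div_left_comm, mul_comm]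
      gcongr
    linarith
  have trig : ∀ p q u v : ℝ, |u| ≤ 1 → |v| ≤ 1 → |p * u + q * v| ≤ |p| + |q| := by
    intro p q u v hu hv
    refine (abs_add_le _ _).trans (add_le_add ?_ ?_) <;> rw [abs_mul]
    · exact mul_le_of_le_one_right (abs_nonneg _) hu
    · exact mul_le_of_le_one_right (abs_nonneg _) hv
  have hcos := abs_sub_le_rpow_sub_rpow (g := fun s => f s * Real.cos s)
    (g' := fun s => f' s * Real.cos s + f s * -Real.sin s) hx₀ hα
    (fun s hs => (hd s hs).mul (Real.hasDerivAt_cos s).hasDerivWithinAt)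
    (fun s hs => (trig _ _ _ _ (Real.abs_cos_le_one s)
      (by rw [abs_neg]; exact Real.abs_sin_le_one s)).trans (key s hs)) hx hxy
  have hsin := abs_sub_le_rpow_sub_rpow (g := fun s => f s * Real.sin s)
    (g' := fun s => f' s * Real.sin s + f s * Real.cos s) hx₀ hα
    (fun s hs => (hd s hs).mul (Real.hasDerivAt_sin s).hasDerivWithinAt)
    (fun s hs => (trig _ _ _ _ (Real.abs_sin_le_one s) (Real.abs_cos_le_one s)).trans
      (key s hs)) hx hxy
  refine (EuclideanSpace.dist_fin_two_le _ _).trans ?_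
  simp only [Matrix.cons_val_zero, Matrix.cons_val_one]
  linarith

/-! ### Inner disc and outer arc of the spiral. -/

theorem norm_polar (ρ θ : ℝ) :
    ‖(!₂[ρ * Real.cos θ, ρ * Real.sin θ] : EuclideanSpace ℝ (Fin 2))‖ = |ρ| := by
  have h := EuclideanSpace.dist_polar ρ 0 θ
  have e : (!₂[0 * Real.cos θ, 0 * Real.sin θ] : EuclideanSpace ℝ (Fin 2)) = 0 := by
    ext i; fin_cases i <;> simp
  rwa [e, dist_zero_right, sub_zero] at h

theorem exists_polar_eq (y : EuclideanSpace ℝ (Fin 2)) (Φ : ℝ) :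
    ∃ θ ∈ Ico Φ (Φ + 2 * Real.pi), y = !₂[‖y‖ * Real.cos θ, ‖y‖ * Real.sin θ] := by
  set z : ℂ := ⟨y 0, y 1⟩ with hz
  have hn : ‖z‖ = ‖y‖ := by
    rw [EuclideanSpace.norm_eq, Fin.sum_univ_two, Complex.norm_eq_sqrt_sq_add_sq]
    simp [hz]
  have hc := Complex.norm_mul_cos_arg z
  have hs := Complex.norm_mul_sin_arg z
  refine ⟨toIcoMod Real.two_pi_pos Φ z.arg, toIcoMod_mem_Ico _ _ _, ?_⟩
  have e : toIcoMod Real.two_pi_pos Φ z.arg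
      = z.arg - (toIcoDiv Real.two_pi_pos Φ z.arg : ℤ) * (2 * Real.pi) := by
    rw [toIcoMod, zsmul_eq_mul]
  rw [e, Real.cos_sub_int_mul_two_pi, Real.sin_sub_int_mul_two_pi, ← hn, hc, hs]
  ext i; fin_cases i <;> simp [hz]

/-- On the ray through `y`, the radii `f (θ + 2 * k * π)` start above `‖y‖`, tend to `0` and change
by less than `ε` per turn. The first one not exceeding `‖y‖` is thus within `ε` of it; the radii
need not be monotone. -/
theorem ball_subset_thickening_polarGraph {f : ℝ → ℝ} {x₀ Φ R ε : ℝ} (hΦ : x₀ ≤ Φ) (hε : 0 < ε)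
    (hf0 : Tendsto f atTop (𝓝 0)) (hpos : ∀ x, x₀ ≤ x → 0 < f x)
    (hgap : ∀ x, Φ ≤ x → |f (x + 2 * Real.pi) - f x| < ε)
    (hR : ∀ x ∈ Ico Φ (Φ + 2 * Real.pi), R ≤ f x) :
    Metric.ball 0 R ⊆ Metric.thickening ε (polarGraph f (Ici x₀)) := by
  intro y hy
  obtain ⟨θ, hθ, hyθ⟩ := exists_polar_eq y Φ
  rw [mem_ball_zero_iff] at hy
  have hπ := Real.pi_pos
  have hge : ∀ k : ℕ, Φ ≤ θ + k * (2 * Real.pi) := fun k =>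
    hθ.1.trans (le_add_of_nonneg_right (by positivity))
  have htend : Tendsto (fun k : ℕ => f (θ + k * (2 * Real.pi))) atTop (𝓝 0) :=
    hf0.comp (tendsto_atTop_add_const_left _ _
      (tendsto_natCast_atTop_atTop.atTop_mul_const (by positivity)))
  obtain ⟨k, hk⟩ : ∃ k : ℕ, |f (θ + k * (2 * Real.pi)) - ‖y‖| < ε := by
    rcases (norm_nonneg y).eq_or_lt with h0 | h0
    · obtain ⟨k, hk⟩ := (htend.eventually (gt_mem_nhds hε)).exists
      refine ⟨k, ?_⟩
      rwa [← h0, sub_zero, abs_of_pos (hpos _ (hΦ.trans (hge k)))]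
    · have hex : ∃ k : ℕ, f (θ + k * (2 * Real.pi)) ≤ ‖y‖ :=
        ((htend.eventually (gt_mem_nhds h0)).mono fun k hk => le_of_lt hk).exists
      classical
      have hspec := Nat.find_spec hex
      have hmin := fun m => Nat.find_min (m := m) hex
      generalize Nat.find hex = n at hspec hmin
      rcases n with _ | n
      · have := hR θ hθ
        simp only [Nat.cast_zero, zero_mul, add_zero] at hspec
        linarith
      · have h1 := hmin n (Nat.lt_succ_self n)
        have h2 := hgap _ (hge n)
        rw [show θ + n * (2 * Real.pi) + 2 * Real.pi = θ + (n + 1 : ℕ) * (2 * Real.pi) by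
          push_cast; ring] at h2
        refine ⟨n + 1, ?_⟩
        rw [abs_lt] at h2 ⊢
        constructor <;> linarith
  refine Metric.mem_thickening_iff.2 ⟨_, ⟨θ + k * (2 * Real.pi), hΦ.trans (hge k), rfl⟩, ?_⟩
  rw [hyθ]
  simp only [Real.cos_add_nat_mul_two_pi, Real.sin_add_nat_mul_two_pi]
  rwa [EuclideanSpace.dist_polar, abs_sub_comm]

theorem thickening_polarGraph_subset {f : ℝ → ℝ} {x₀ Φ R ε : ℝ}
    (hR : ∀ x, Φ ≤ x → |f x| ≤ R) :
    Metric.thickening ε (polarGraph f (Ici x₀)) ⊆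
      Metric.ball 0 (R + ε) ∪ Metric.thickening ε (polarGraph f (Icc x₀ Φ)) := by
  intro z hz
  obtain ⟨_, ⟨x, hx, rfl⟩, hzx⟩ := Metric.mem_thickening_iff.1 hz
  rcases le_total x Φ with h | h
  · exact Or.inr (Metric.mem_thickening_iff.2 ⟨_, ⟨x, ⟨hx, h⟩, rfl⟩, hzx⟩)
  · refine Or.inl (Metric.mem_ball.2 ?_)
    have h1 := norm_polar (f x) x
    have h2 := hR x h
    have h3 := dist_triangle z (!₂[f x * Real.cos x, f x * Real.sin x]) 0
    rw [dist_zero_right (!₂[f x * Real.cos x, f x * Real.sin x] : EuclideanSpace ℝ (Fin 2)), h1]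
      at h3
    simp only at hzx
    linarith

/-- The parameter `u = x ^ β` makes the arc `L`-Lipschitz, so the covering bound applies. -/
theorem volume_thickening_polarGraph_Icc_le {f : ℝ → ℝ} {x₀ Φ L β ε : ℝ} (hx₀ : 0 < x₀)
    (hΦ : x₀ ≤ Φ) (hβ : 0 < β) (hL : 0 < L) (hε : 0 < ε)
    (hf : ∀ x y, x₀ ≤ x → x ≤ y →
      dist (!₂[f x * Real.cos x, f x * Real.sin x] : EuclideanSpace ℝ (Fin 2))
        !₂[f y * Real.cos y, f y * Real.sin y] ≤ L * (y ^ β - x ^ β)) :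
    volume (Metric.thickening ε (polarGraph f (Icc x₀ Φ))) ≤
      ENNReal.ofReal ((L * Φ ^ β / ε + 1) * (4 * ε ^ 2 * Real.pi)) := by
  set γ : ℝ → EuclideanSpace ℝ (Fin 2) := fun x => !₂[f x * Real.cos x, f x * Real.sin x] with hγ
  have hx₀β : 0 < x₀ ^ β := Real.rpow_pos_of_pos hx₀ β
  have hsub : polarGraph f (Icc x₀ Φ) ⊆ (fun u => γ (u ^ β⁻¹)) '' Icc (x₀ ^ β) (Φ ^ β) := by
    rintro _ ⟨x, hx, rfl⟩
    have hx0 : 0 ≤ x := hx₀.le.trans hx.1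
    refine ⟨x ^ β, ⟨Real.rpow_le_rpow hx₀.le hx.1 hβ.le, Real.rpow_le_rpow hx0 hx.2 hβ.le⟩, ?_⟩
    simp only [Real.rpow_rpow_inv hx0 hβ.ne', hγ]
  refine (measure_mono (Metric.thickening_subset_of_subset ε hsub)).trans
    ((volume_thickening_image_Icc_le hL hε (Real.rpow_le_rpow hx₀.le hΦ hβ.le) ?_).trans ?_)
  · intro u v hu huv _
    have hu0 : 0 ≤ u := hx₀β.le.trans hu
    have h := hf (u ^ β⁻¹) (v ^ β⁻¹)
      (by
        rw [← Real.rpow_rpow_inv hx₀.le hβ.ne']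
        exact Real.rpow_le_rpow hx₀β.le hu (inv_nonneg.2 hβ.le))
      (Real.rpow_le_rpow hu0 huv (inv_nonneg.2 hβ.le))
    rwa [Real.rpow_inv_rpow hu0 hβ.ne', Real.rpow_inv_rpow (hu0.trans huv) hβ.ne'] at h
  · refine ENNReal.ofReal_le_ofReal ?_
    have : Φ ^ β - x₀ ^ β ≤ Φ ^ β := by linarith
    have hπ := Real.pi_pos
    gcongr

/-! ### Two-sided area bounds and the dimension. -/

theorem eventually_volume_thickening_polarGraph_le {f : ℝ → ℝ} {x₀ m L α : ℝ} (hx₀ : 0 < x₀)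
    (hα0 : 0 < α) (hα1 : α < 1) (hm : 0 < m) (hL : 0 < L)
    (hf : ∀ x, x₀ ≤ x → |f x| ≤ m * x ^ (-α))
    (hdist : ∀ x y, x₀ ≤ x → x ≤ y →
      dist (!₂[f x * Real.cos x, f x * Real.sin x] : EuclideanSpace ℝ (Fin 2))
        !₂[f y * Real.cos y, f y * Real.sin y] ≤ L * (y ^ (1 - α) - x ^ (1 - α))) :
    ∀ᶠ ε : ℝ in 𝓝[>] 0, volume (Metric.thickening ε (polarGraph f (Ici x₀))) ≤
      ENNReal.ofReal (((m + 1) ^ 2 + 4 * L + 4) * Real.pi * ε ^ (2 * (α / (1 + α)))) := by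
  have hα : 0 < 1 + α := by linarith
  have hone : ∀ᶠ ε : ℝ in 𝓝[>] 0, ε < 1 :=
    (eventually_lt_nhds one_pos).filter_mono nhdsWithin_le_nhds
  have hlarge : ∀ᶠ ε : ℝ in 𝓝[>] 0, x₀ ≤ ε ^ (-(1 / (1 + α))) :=
    (tendsto_rpow_neg_nhdsGT_zero (neg_neg_of_pos (by positivity))).eventually_ge_atTop x₀
  filter_upwards [self_mem_nhdsWithin, hone, hlarge] with ε hε h1 hΦ
  rw [mem_Ioi] at hε
  -- This cut balances the two pieces: `Φ ^ (-α) = D` sets the disc radius, and `Φ ^ (1 - α) * ε = D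
  -- ^ 2` the area around the arc.
  set Φ : ℝ := ε ^ (-(1 / (1 + α))) with hΦdef
  set D : ℝ := ε ^ (α / (1 + α)) with hD
  have hD0 : 0 < D := Real.rpow_pos_of_pos hε _
  have hDD : ε ^ (2 * (α / (1 + α))) = D ^ 2 := by
    rw [hD, ← Real.rpow_natCast, ← Real.rpow_mul hε.le, mul_comm]; rfl
  have hΦα : Φ ^ (-α) = D := by
    rw [hD, hΦdef, ← Real.rpow_mul hε.le]; congr 1; ring
  have hΦα' : Φ ^ (1 - α) * ε = D ^ 2 := by
    rw [← hDD, hΦdef, ← Real.rpow_mul hε.le, ← Real.rpow_add_one hε.ne']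
    congr 1; field_simp; ring
  have hεD : ε ≤ D := by
    rw [hD]
    refine Real.self_le_rpow_of_le_one hε.le h1.le ?_
    rw [div_le_one hα]; linarith
  have hΦ0 : 0 < Φ := hx₀.trans_le hΦ
  have htail : ∀ x, Φ ≤ x → |f x| ≤ m * D := by
    intro x hx
    refine (hf x (hΦ.trans hx)).trans ?_
    rw [← hΦα]
    exact mul_le_mul_of_nonneg_left (Real.rpow_le_rpow_of_nonpos hΦ0 hx (by linarith)) hm.le
  have hπ := Real.pi_pos
  have hΦp : 0 < Φ ^ (1 - α) := Real.rpow_pos_of_pos hΦ0 _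
  refine (measure_mono (thickening_polarGraph_subset htail)).trans ((measure_union_le _ _).trans
    ((add_le_add (EuclideanSpace.volume_ball_fin_two_of_nonneg _ (by positivity)).le
      (volume_thickening_polarGraph_Icc_le hx₀ hΦ (by linarith) hL hε hdist)).trans ?_))
  rw [← ENNReal.ofReal_add (by positivity) (by positivity), hDD]
  refine ENNReal.ofReal_le_ofReal ?_
  have e : (L * Φ ^ (1 - α) / ε + 1) * (4 * ε ^ 2 * Real.pi)
      = (4 * L * D ^ 2 + 4 * ε ^ 2) * Real.pi := by
    rw [← hΦα']; field_simp
  rw [e, ← add_mul, mul_right_comm _ Real.pi]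
  refine mul_le_mul_of_nonneg_right ?_ hπ.le
  have h2 : ε ^ 2 ≤ D ^ 2 := pow_le_pow_left₀ hε.le hεD 2
  have h3 : (m * D + ε) ^ 2 ≤ ((m + 1) * D) ^ 2 := pow_le_pow_left₀ (by positivity) (by linarith) 2
  rw [mul_pow] at h3
  linarith

theorem eventually_le_volume_thickening_polarGraph {f f' : ℝ → ℝ} {x₀ m M α : ℝ} (hx₀ : 0 < x₀)
    (hα : 0 < α) (hm : 0 < m) (hM : 0 < M) (hf0 : Tendsto f atTop (𝓝 0))
    (hf : ∀ x, x₀ ≤ x → m * x ^ (-α) ≤ f x)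
    (hd : ∀ x, x₀ ≤ x → HasDerivWithinAt f (f' x) (Ici x₀) x)
    (hf' : ∀ x, x₀ ≤ x → |f' x| ≤ M * x ^ (-α - 1)) :
    ∀ᶠ ε : ℝ in 𝓝[>] 0,
      ENNReal.ofReal ((m * (2 * (4 * Real.pi * M) ^ (1 / (1 + α))) ^ (-α)) ^ 2 * Real.pi *
        ε ^ (2 * (α / (1 + α)))) ≤
      volume (Metric.thickening ε (polarGraph f (Ici x₀))) := by
  have hα1 : 0 < 1 + α := by linarith
  have hπ := Real.pi_pos
  -- Chosen so that the mean value bound `2 * π * M * Φ ^ (-α - 1)` on the change over one turn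
  -- equals `ε / 2`, leaving room for a strict inequality.
  set K : ℝ := (4 * Real.pi * M) ^ (1 / (1 + α)) with hK
  have hK0 : 0 < K := Real.rpow_pos_of_pos (by positivity) _
  -- `Φ ≥ 2 * π` keeps the first turn after `Φ` below `2 * Φ`, whence the factor `2` in the radius.
  have hlarge : ∀ᶠ ε : ℝ in 𝓝[>] 0, max x₀ (2 * Real.pi) ≤ K * ε ^ (-(1 / (1 + α))) :=
    ((tendsto_rpow_neg_nhdsGT_zero (neg_neg_of_pos (by positivity))).const_mul_atTop
      hK0).eventually_ge_atTop _
  filter_upwards [self_mem_nhdsWithin, hlarge] with ε hε hΦmax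
  rw [mem_Ioi] at hε
  set Φ : ℝ := K * ε ^ (-(1 / (1 + α))) with hΦdef
  have hΦ : x₀ ≤ Φ := (le_max_left _ _).trans hΦmax
  have hΦπ : 2 * Real.pi ≤ Φ := (le_max_right _ _).trans hΦmax
  have hΦ0 : 0 < Φ := hx₀.trans_le hΦ
  have hεp := Real.rpow_pos_of_pos hε (-(1 / (1 + α)))
  have hΦα : 2 * Real.pi * (M * Φ ^ (-α - 1)) = ε / 2 := by
    have e1 : K ^ (-α - 1) = (4 * Real.pi * M)⁻¹ := by
      rw [hK, ← Real.rpow_mul (by positivity), ← Real.rpow_neg_one]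
      congr 1; field_simp; ring
    have e2 : (ε ^ (-(1 / (1 + α)))) ^ (-α - 1) = ε := by
      rw [← Real.rpow_mul hε.le]
      conv_rhs => rw [← Real.rpow_one ε]
      congr 1; field_simp; ring
    rw [hΦdef, Real.mul_rpow hK0.le hεp.le, e1, e2]
    field_simp; norm_num
  have hgap : ∀ x, Φ ≤ x → |f (x + 2 * Real.pi) - f x| < ε := by
    intro x hx
    have hsub : Icc x (x + 2 * Real.pi) ⊆ Ici x₀ := fun s hs => (hΦ.trans hx).trans hs.1
    have h := (convex_Icc x (x + 2 * Real.pi)).norm_image_sub_le_of_norm_hasDerivWithin_le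
      (f := f) (f' := f') (C := M * Φ ^ (-α - 1)) (fun s hs => (hd s (hsub hs)).mono hsub)
      (fun s hs => (hf' s (hsub hs)).trans (mul_le_mul_of_nonneg_left
        (Real.rpow_le_rpow_of_nonpos hΦ0 (hx.trans hs.1) (by linarith)) hM.le))
      (left_mem_Icc.2 (by linarith)) (right_mem_Icc.2 (by linarith))
    rw [Real.norm_eq_abs, Real.norm_eq_abs, add_sub_cancel_left,
      abs_of_pos (by positivity : 0 < 2 * Real.pi)] at h
    linarith
  have hR : ∀ x ∈ Ico Φ (Φ + 2 * Real.pi), m * (2 * Φ) ^ (-α) ≤ f x := fun x hx =>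
    (mul_le_mul_of_nonneg_left (Real.rpow_le_rpow_of_nonpos (hΦ0.trans_le hx.1)
      (by linarith [hx.2]) (by linarith)) hm.le).trans (hf x (hΦ.trans hx.1))
  have hpos : ∀ x, x₀ ≤ x → 0 < f x := fun x hx =>
    (mul_pos hm (Real.rpow_pos_of_pos (hx₀.trans_le hx) _)).trans_le (hf x hx)
  refine le_trans ?_ (measure_mono (ball_subset_thickening_polarGraph hΦ hε hf0 hpos hgap hR))
  rw [EuclideanSpace.volume_ball_fin_two_of_nonneg _ (by positivity)]
  refine ENNReal.ofReal_le_ofReal (le_of_eq ?_)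
  have e3 : (2 * Φ) ^ (-α) = (2 * K) ^ (-α) * ε ^ (α / (1 + α)) := by
    rw [hΦdef, ← mul_assoc, Real.mul_rpow (by positivity) hεp.le, ← Real.rpow_mul hε.le]
    congr 2; ring
  have e4 : ε ^ (2 * (α / (1 + α))) = (ε ^ (α / (1 + α))) ^ 2 := by
    rw [← Real.rpow_natCast, ← Real.rpow_mul hε.le, mul_comm]; rfl
  rw [e3, e4]
  ring

theorem hasBoxDim_polarGraph {f f' : ℝ → ℝ} {x₀ m₁ m₂ M α : ℝ} (hx₀ : 0 < x₀)
    (hα0 : 0 < α) (hα1 : α < 1) (hm₁ : 0 < m₁) (hM : 0 < M)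
    (hf0 : Tendsto f atTop (𝓝 0))
    (hlow : ∀ x, x₀ ≤ x → m₁ * x ^ (-α) ≤ f x) (hup : ∀ x, x₀ ≤ x → f x ≤ m₂ * x ^ (-α))
    (hd : ∀ x, x₀ ≤ x → HasDerivWithinAt f (f' x) (Ici x₀) x)
    (hf' : ∀ x, x₀ ≤ x → |f' x| ≤ M * x ^ (-α - 1)) :
    HasBoxDim (polarGraph f (Ici x₀)) (2 / (1 + α)) := by
  have hα : 0 < 1 + α := by linarith
  have h1α : 0 < 1 - α := by linarith
  have hπ := Real.pi_pos
  have hpos : ∀ x, x₀ ≤ x → 0 < f x := fun x hx =>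
    (mul_pos hm₁ (Real.rpow_pos_of_pos (hx₀.trans_le hx) _)).trans_le (hlow x hx)
  have habs : ∀ x, x₀ ≤ x → |f x| ≤ m₂ * x ^ (-α) := fun x hx => by
    rw [abs_of_pos (hpos x hx)]; exact hup x hx
  have hm₂ : 0 < m₂ :=
    pos_of_mul_pos_left ((hpos x₀ le_rfl).trans_le (hup x₀ le_rfl)) (Real.rpow_nonneg hx₀.le _)
  have hexp : ((2 : ℕ) : ℝ) - 2 / (1 + α) = 2 * (α / (1 + α)) := by
    push_cast; field_simp; ring
  refine hasBoxDim_of_volume_bounds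
    (c := (m₁ * (2 * (4 * Real.pi * M) ^ (1 / (1 + α))) ^ (-α)) ^ 2 * Real.pi)
    (C := ((m₂ + 1) ^ 2 + 4 * (2 * ((M / x₀ + m₂) / (1 - α))) + 4) * Real.pi)
    ?_ (by positivity) (by positivity) ?_ ?_
  · refine (Metric.isBounded_closedBall (x := 0) (r := m₂ * x₀ ^ (-α))).subset ?_
    rintro _ ⟨x, hx, rfl⟩
    rw [mem_closedBall_zero_iff, norm_polar]
    exact (habs x hx).trans (mul_le_mul_of_nonneg_left
      (Real.rpow_le_rpow_of_nonpos hx₀ hx (by linarith)) hm₂.le)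
  · rw [hexp]
    exact eventually_le_volume_thickening_polarGraph hx₀ hα0 hm₁ hM hf0 hlow hd hf'
  · rw [hexp]
    exact eventually_volume_thickening_polarGraph_le hx₀ hα0 hα1 hm₂ (by positivity) habs
      fun x y hx hxy => dist_polarCurve_le hx₀ hα1 hM.le habs hd hf' hx hxy

/-! ### Transfer of waviness and the reparametrization. -/

theorem IsWaveSequence.congr {t₀ : ℝ} {r r' : ℝ → ℝ} {t : ℕ → ℝ} (h : IsWaveSequence t₀ r t)
    (ht : Monotone t) (hr : EqOn r' r (Ici t₀)) : IsWaveSequence t₀ r' t := by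
  have hge : ∀ n, t₀ ≤ t n := fun n => h.zero ▸ ht n.zero_le
  refine ⟨h.zero, fun k => ?_, fun k => ?_⟩
  · convert h.odd k using 1
    ext s
    refine and_congr_right fun hs => ?_
    have hs' : s ∈ Ici t₀ := (hge _).trans (le_of_lt hs)
    rw [derivWithin_congr hr (hr hs')]
  · convert h.even k using 1
    ext s
    refine and_congr_right fun hs => ?_
    have hs' : s ∈ Ici t₀ := (hge _).trans (le_of_lt hs)
    rw [hr hs', hr (hge (2 * k + 1))]

/-- Needed because `f ∘ φ` and `r` agree only on `Ici t₀`; derivatives within `Ici t₀` and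
oscillations after `t₀` see nothing else. -/
theorem IsWavyFunctionWith.congr {t₀ ε α : ℝ} {r r' : ℝ → ℝ} (h : IsWavyFunctionWith t₀ r ε α)
    (hr : EqOn r' r (Ici t₀)) : IsWavyFunctionWith t₀ r' ε α := by
  obtain ⟨t, ht, hw⟩ := h.wavy
  have hge : ∀ n, t₀ ≤ t n := fun n => ht.zero ▸ hw.strictMono.monotone n.zero_le
  refine ⟨fun s hs => (hr hs).symm ▸ h.pos s hs, h.contDiffOn.congr hr, ?_,
    t, ht.congr hw.strictMono.monotone hr, { hw with osc_isLittleO := ?_ }⟩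
  · rw [derivWithin_congr hr (hr self_mem_Ici)]
    exact h.deriv_start
  · refine hw.osc_isLittleO.congr_left fun k => ?_
    have : EqOn r' r (Icc (t (2 * k + 1)) (t (2 * k + 2))) :=
      hr.mono fun s hs => (hge _).trans hs.1
    rw [oscOn, oscOn, this.image_eq]

theorem image_Ici_eq_of_tendsto_atTop {φ : ℝ → ℝ} {a : ℝ} (hmono : MonotoneOn φ (Ici a))
    (hcont : ContinuousOn φ (Ici a)) (hlim : Tendsto φ atTop atTop) :
    φ '' Ici a = Ici (φ a) := by
  refine Subset.antisymm ?_ fun y hy => ?_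
  · rintro _ ⟨s, hs, rfl⟩
    exact hmono self_mem_Ici hs hs
  · obtain ⟨b, hb, hab⟩ := ((hlim.eventually_ge_atTop y).and (eventually_ge_atTop a)).exists
    obtain ⟨s, hs, rfl⟩ := intermediate_value_Icc hab (hcont.mono Icc_subset_Ici_self) ⟨hy, hb⟩
    exact ⟨s, hs.1, rfl⟩

theorem tendsto_atTop_of_abs_sub_tendsto_zero {φ : ℝ → ℝ} {a b : ℝ}
    (h : Tendsto (fun s => |(φ s - b) - (s - a)|) atTop (𝓝 0)) : Tendsto φ atTop atTop := by
  refine tendsto_atTop_mono' atTop (f₁ := fun s => s + (b - a - 1)) ?_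
    (tendsto_atTop_add_const_right _ _ tendsto_id)
  filter_upwards [h.eventually (gt_mem_nhds one_pos)] with s hs
  have := neg_abs_le ((φ s - b) - (s - a))
  linarith

theorem theorem3 (t₀ : ℝ) (ht₀ : 0 < t₀) (r : ℝ → ℝ) (ε α : ℝ)
    (hr : IsWavyFunctionWith t₀ r ε α)
    (φ : ℝ → ℝ) (φ₀ : ℝ) (hφ₀ : 0 < φ₀) (hφt₀ : φ t₀ = φ₀)
    (hφmono : StrictMonoOn φ (Ici t₀)) (hφC1 : ContDiffOn ℝ 1 φ (Ici t₀))
    (hφlim : ∃ φbar : ℝ, Tendsto (fun s => |(φ s - φbar) - (s - t₀)|) atTop (𝓝 0))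
    (f : ℝ → ℝ) (hf : ∀ s, t₀ ≤ s → f (φ s) = r s)
    (hspiral : IsSpiral f φ₀)
    (ε' : ℝ) (hε' : 0 < ε') (hε'ε : ε' < ε)
    (mlow mup a M : ℝ) (hmlow : 0 < mlow) (hmup : 0 < mup) (ha : 0 < a) (hM : 0 < M)
    (hbound : ∀ x, φ₀ ≤ x → mlow * x ^ (-α) ≤ f x ∧ f x ≤ mup * x ^ (-α))
    (hfdiff : DifferentiableOn ℝ f (Ici φ₀))
    (hfderiv : ∀ x, φ₀ ≤ x → |derivWithin f (Ici φ₀) x| ≤ M * x ^ (-α - 1))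
    (hdecr : ∀ x, φ₀ ≤ x → ∀ Δ : ℝ,
      min ε' Real.pi ≤ Δ → Δ ≤ 2 * Real.pi + min ε' Real.pi →
        a * x ^ (-α - 1) ≤ f x - f (x + Δ)) :
    IsWavySpiral f (Ici φ₀) ∧
      HasBoxDim (polarGraph f (Ici φ₀)) (2 / (1 + α)) := by
  obtain ⟨_, -, hw⟩ := hr.wavy
  obtain ⟨φbar, hφbar⟩ := hφlim
  refine ⟨⟨⟨φ₀, Or.inl ⟨rfl, hspiral⟩⟩, t₀, φ, hφC1, Or.inl hφmono, ?_, ε, α, hr.congr hf⟩, ?_⟩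
  -- The asymptotics of `φ` make it unbounded, so it runs over the whole domain of `f`.
  · rw [image_Ici_eq_of_tendsto_atTop hφmono.monotoneOn hφC1.continuousOn
      (tendsto_atTop_of_abs_sub_tendsto_zero hφbar), hφt₀]
  · exact hasBoxDim_polarGraph hφ₀ hw.alpha_mem.1 hw.alpha_mem.2 hmlow hM hspiral.tendsto_zero
      (fun x hx => (hbound x hx).1) (fun x hx => (hbound x hx).2)
      (fun x hx => (hfdiff x hx).hasDerivWithinAt) hfderiv
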